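/- **Lemma 3.1.** A *closed 2D discrete surface* $D$ is a finite polygonal cell complex without boundary, with vertices, edges and faces (for example a triangulated or a cubical one): every edge has exactly two end points and lies on exactly two faces, the boundary of every face is a simple closed polygon, and the edges and faces around every vertex form a single cycle. Call two cells *incident* if one is a face of the other or they are equal. A *path* in a set $S$ of cells is a finite sequence of cells of $S$ with consecutive cells incident; two paths are *homotopic in $S$* if they are related by finitely many elementary moves and their inverses, the moves being to replace three consecutive pairwise incident cells $a,b,c\in S$ by $a,c$, and to replace $a,a$ by $a$. The set $S$ is *connected* if any two of its cells are joined by a path in $S$ (so the empty set is connected), and *simply connected* if it is non-empty and connected and every closed path in $S$ is homotopic in $S$ to the constant path at its base point. A *partition* of $D$ is given by its edge network $\Gamma$, a set of edges and vertices of $D$ that contains both end points of each of its edges. Its *patches* are the connected components $U$ of $D\setminus\Gamma$. The *closed patch* $\overline U$ consists of the cells of $U$ and all their faces (of every dimension), and the *boundary* of $U$ is $\overline U\cap\Gamma$. Let $D$ be a simply connected closed 2D discrete surface, and let $\Gamma$ be the edge network of a partition of $D$ such that $\Gamma$ is connected. Then every patch $U$ is simply connected. Moreover, if the boundary of $U$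 is a (possibly empty) disjoint union of simple closed curves, that is, if exactly two boundary edges end at every boundary vertex, then the closed patch $\overline U$ is simply connected as well. -/

import Mathlib

/-! Finite cell complexes are described by their partially ordered set of (open) cells, where `a ≤ b`
means that the cell `a` is a face of the cell `b`.  A region is a set of cells. -/

namespace DiscreteSurface

section Regions

variable {C : Type*} [PartialOrder C]

/-- Two cells are incident if one of them is a face of the other (possibly both are equal). -/
def Incident (a b : C) : Prop := a ≤ b ∨ b ≤ a

/-- `a` and `b` can be joined by a path of successively incident cells of the region `S`. -/
def Linked (S : Set C) (a b : C) : Prop :=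
  Relation.ReflTransGen (fun x y => x ∈ S ∧ y ∈ S ∧ Incident x y) a b

/-- Any two cells of the region can be joined inside the region (the empty region is allowed). -/
def IsPreconnectedRegion (S : Set C) : Prop := ∀ a ∈ S, ∀ b ∈ S, Linked S a b

/-- A non-empty region in which any two cells can be joined. -/
def IsConnectedRegion (S : Set C) : Prop := S.Nonempty ∧ IsPreconnectedRegion S

/-- A path in the region `S`: a list of cells of `S`, consecutive ones being incident.  These are the
edge paths of the barycentric subdivision: a cell is represented by its barycentre. -/
def IsPathIn (S : Set C) (l : List C) : Prop := l.IsChain Incident ∧ ∀ x ∈ l, x ∈ S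

/-- The elementary deformations of paths in the region `S`: a detour `a, b, c` along a triangle
of the barycentric subdivision (three pairwise incident cells) is replaced by `a, c`, and a
repeated cell is written only once.  As `c = a` is allowed in the first rule, the two rules
together remove a backtracking `a, b, a`. -/
inductive ElementaryMove (S : Set C) : List C → List C → Prop
  | triangle (p q : List C) (a b c : C) (ha : a ∈ S) (hb : b ∈ S) (hc : c ∈ S)
      (hab : Incident a b) (hbc : Incident b c) (hac : Incident a c) :
      ElementaryMove S (p ++ a :: b :: c :: q) (p ++ a :: c :: q)
  | stutter (p q : List C) (a : C) (ha : a ∈ S) :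
      ElementaryMove S (p ++ a :: a :: q) (p ++ a :: q)

/-- Homotopy of paths with fixed end points in the region `S`: finitely many elementary
deformations and their inverses. -/
def HomotopicIn (S : Set C) : List C → List C → Prop := Relation.EqvGen (ElementaryMove S)

/-- A region is simply connected if it is non-empty and connected and every closed path in it
is contractible in it to the constant path at its base point. -/
def IsSimplyConnected (S : Set C) : Prop :=
  IsConnectedRegion S ∧
    ∀ (a : C) (l : List C), IsPathIn S (a :: (l ++ [a])) →
      HomotopicIn S (a :: (l ++ [a])) [a]

end Regions

/-- A closed 2D discrete surface on the set of cells `C`: a finite 2-dimensional polygonal cell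
complex without boundary (for example a triangulated or a cubical one).  Every edge has two end
points and lies on two faces, the boundary of every face is a simple closed polygon, and the
edges and faces around every vertex form a single cycle.  Connectedness is not part of the
definition. -/
structure ClosedSurface (C : Type*) [PartialOrder C] where
  finite : Finite C
  /-- The dimension of a cell: vertices, edges and faces have dimension 0, 1 and 2. -/
  dim : C → ℕ
  dim_le_two : ∀ c, dim c ≤ 2
  dim_strictMono : StrictMono dim
  edge_vertices : ∀ e, dim e = 1 → (Set.Iio e).ncard = 2
  edge_faces : ∀ e, dim e = 1 → (Set.Ioi e).ncard = 2
  /-- If `v` is a vertex of the face `f`, then exactly two edges of `f` end at `v`. -/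
  corner_edges : ∀ v f, dim v = 0 → dim f = 2 → v < f → (Set.Ioo v f).ncard = 2
  face_boundary_connected : ∀ f, dim f = 2 → IsConnectedRegion (Set.Iio f)
  vertex_star_connected : ∀ v, dim v = 0 → IsConnectedRegion (Set.Ioi v)

/-- A partition of a discrete surface is given by its edge network: a set of edges and vertices
of the surface that contains the end points of its edges.  The patches are the pieces into which
the network cuts the surface. -/
structure Partition {C : Type*} [PartialOrder C] (M : ClosedSurface C) where
  network : Set C
  isLowerSet : IsLowerSet network
  dim_le_one : ∀ c ∈ network, M.dim c ≤ 1

namespace Partition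

variable {C : Type*} [PartialOrder C] {M : ClosedSurface C}

/-- A patch (without its boundary) is a connected component of the complement of the network. -/
def IsPatch (P : Partition M) (U : Set C) : Prop :=
  ∃ x ∈ P.networkᶜ, U = {y | Linked P.networkᶜ x y}

/-- The closed patch: all cells of the patch together with all their faces. -/
def closedPatch (_P : Partition M) (U : Set C) : Set C := {c | ∃ d ∈ U, c ≤ d}

/-- The boundary of a patch: the part of the network that lies on the closed patch. -/
def patchBoundary (P : Partition M) (U : Set C) : Set C := P.closedPatch U ∩ P.network

/-- The boundary of the patch `U` is a disjoint union of simple closed curves (there may be none):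
exactly two boundary edges end at every boundary vertex. -/
def HasSimpleBoundary (P : Partition M) (U : Set C) : Prop :=
  ∀ v ∈ P.patchBoundary U, M.dim v = 0 → {e | e ∈ P.patchBoundary U ∧ v < e}.ncard = 2

end Partition

end DiscreteSurface

/-! For a connected region, simple connectivity is equivalent to the triviality of all group-valued
cocycles on its order complex: every such cocycle has a potential
(`IsSimplyConnected.hasPotentials`, `isSimplyConnected_of_hasPotentials`). Homotopies of paths are
thus replaced by an extension problem. A potential extends over a new cell whose link in the region
is connected (`HasPotentials.union`), a weak form of van Kampen's theorem.

Choose a maximal tree in the network and extend it to a spanning tree of the surface. The complement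
of the spanning tree is assembled by gluing faces across non-tree edges
(`TreeGrowth.hasPotentials_compl_of_spanning`). That nothing is left out rests on mod 2 homology: a
tree contains no nonempty even edge set, and by simple connectivity every even edge set bounds a set
of faces (`exists_sideSum_eq`). Peeling off leaves restores the complement of the smaller tree.
Passing from there to the complement of the network removes only edges without end points in the
region, and each patch is a component of what remains.

For the closed patch, the boundary edges and then the boundary vertices are added. A simple boundary
is an even edge set, hence bounds, hence has the patch on at most one side of each edge; this makes
the links of the added cells connected. -/

namespace DiscreteSurface

/-! ### Group-valued cocycles and their potentials -/

section Potentials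

variable {C : Type*} [PartialOrder C] {G : Type*} [Group G] {S : Set C}

lemma Incident.symm {a b : C} (h : Incident a b) : Incident b a := Or.symm h

lemma Linked.symm {a b : C} (h : Linked S a b) : Linked S b a :=
  have : Std.Symm (fun x y : C => x ∈ S ∧ y ∈ S ∧ Incident x y) :=
    ⟨fun _ _ h => ⟨h.2.1, h.1, h.2.2.symm⟩⟩
  Relation.ReflTransGen.stdSymm.symm _ _ h

lemma Linked.mono {T : Set C} (hST : S ⊆ T) {a b : C} (h : Linked S a b) : Linked T a b :=
  Relation.ReflTransGen.mono (fun _ _ h => ⟨hST h.1, hST h.2.1, h.2.2⟩) _ _ h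

lemma Linked.single {a b : C} (ha : a ∈ S) (hb : b ∈ S) (h : Incident a b) : Linked S a b :=
  Relation.ReflTransGen.single ⟨ha, hb, h⟩

/-- A property that passes between incident cells of a region is constant along paths. -/
lemma Linked.induction {p : C → Prop} {a b : C} (h : Linked S a b) (ha : p a)
    (hp : ∀ x ∈ S, ∀ y ∈ S, Incident x y → p x → p y) : p b := by
  induction h with
  | refl => exact ha
  | tail _ h ih => exact hp _ h.1 _ h.2.1 h.2.2 ih

lemma Linked.mem {a b : C} (h : Linked S a b) (ha : a ∈ S) : b ∈ S :=
  h.induction ha fun _ _ _ hy _ _ => hy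

lemma isConnectedRegion_of_cone {x : C} (hx : x ∈ S) (h : ∀ a ∈ S, Incident x a) :
    IsConnectedRegion S :=
  ⟨⟨x, hx⟩, fun a ha b hb =>
    (Linked.single ha hx (h a ha).symm).trans (Linked.single hx hb (h b hb))⟩

lemma IsPreconnectedRegion.insert_of_incident (hS : IsPreconnectedRegion S) {x a : C} (ha : a ∈ S)
    (hax : Incident a x) : IsPreconnectedRegion (insert x S) := by
  have key : ∀ b ∈ insert x S, Linked (insert x S) a b := by
    rintro b (rfl | hb)
    · exact Linked.single (Or.inr ha) (Or.inl rfl) hax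
    · exact (hS a ha b hb).mono (Set.subset_insert _ _)
  exact fun b hb c hc => (key b hb).symm.trans (key c hc)

/-- A `G`-valued one-dimensional cocycle on the order complex of a region. -/
def IsCocycleOn (S : Set C) (w : C → C → G) : Prop :=
  ∀ a ∈ S, ∀ b ∈ S, ∀ c ∈ S, a < b → b < c → w a b * w b c = w a c

variable (G) in
/-- Every `G`-valued cocycle on the region is a coboundary, that is, every homomorphism from the
fundamental groupoid of the region to `G` is trivial. -/
def HasPotentials (S : Set C) : Prop :=
  ∀ w : C → C → G, IsCocycleOn S w →
    ∃ g : C → G, ∀ a ∈ S, ∀ b ∈ S, a < b → w a b = (g a)⁻¹ * g b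

open Classical in
/-- The extension of a cocycle to all pairs of incident cells. -/
noncomputable def transport (w : C → C → G) (a b : C) : G :=
  if a < b then w a b else if b < a then (w b a)⁻¹ else 1

lemma transport_self (w : C → C → G) (a : C) : transport w a a = 1 := by simp [transport]

lemma transport_of_lt (w : C → C → G) {a b : C} (h : a < b) : transport w a b = w a b := by
  simp [transport, h]

lemma transport_of_gt (w : C → C → G) {a b : C} (h : b < a) :
    transport w a b = (w b a)⁻¹ := by
  simp [transport, h, h.not_gt]

lemma Incident.eq_or_lt {a b : C} (h : Incident a b) : a = b ∨ a < b ∨ b < a := by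
  rcases h with h | h <;> rcases h.eq_or_lt with h | h <;> simp [h]

lemma IsCocycleOn.transport_mul {w : C → C → G} (hw : IsCocycleOn S w) {a b c : C} (ha : a ∈ S)
    (hb : b ∈ S) (hc : c ∈ S) (hab : Incident a b) (hbc : Incident b c) (hac : Incident a c) :
    transport w a b * transport w b c = transport w a c := by
  rcases hab.eq_or_lt with rfl | hab | hab
  · simp [transport_self]
  · rcases hbc.eq_or_lt with rfl | hbc | hbc
    · simp [transport_self]
    · rw [transport_of_lt w hab, transport_of_lt w hbc, transport_of_lt w (hab.trans hbc)]
      exact hw a ha b hb c hc hab hbc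
    · rw [transport_of_lt w hab, transport_of_gt w hbc]
      rcases hac.eq_or_lt with rfl | hac | hac
      · simp [transport_self]
      · rw [transport_of_lt w hac, ← hw a ha c hc b hb hac hbc]; group
      · rw [transport_of_gt w hac, ← hw c hc a ha b hb hac hab]; group
  · rcases hbc.eq_or_lt with rfl | hbc | hbc
    · simp [transport_self]
    · rw [transport_of_gt w hab, transport_of_lt w hbc]
      rcases hac.eq_or_lt with rfl | hac | hac
      · simp [transport_self]
      · rw [transport_of_lt w hac, ← hw b hb a ha c hc hab hac]; group
      · rw [transport_of_gt w hac, ← hw b hb c hc a ha hbc hac]; group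
    · rw [transport_of_gt w hab, transport_of_gt w hbc, transport_of_gt w (hbc.trans hab),
        ← hw c hc b hb a ha hbc hab]; group

/-- Cells with connected links that are not incident to each other can be added. -/
lemma HasPotentials.union {B : Set C} (hS : HasPotentials G S)
    (hB : ∀ x ∈ B, ∀ y ∈ B, ¬ x < y) (hSB : ∀ x ∈ B, x ∉ S)
    (hl : ∀ x ∈ B, IsConnectedRegion {a | a ∈ S ∧ (a < x ∨ x < a)}) :
    HasPotentials G (S ∪ B) := by
  classical
  intro w hw
  obtain ⟨g, hg⟩ := hS w fun a ha b hb c hc => hw a (Or.inl ha) b (Or.inl hb) c (Or.inl hc)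
  have hg' : ∀ a ∈ S, ∀ b ∈ S, Incident a b → g a * transport w a b = g b := by
    intro a ha b hb hab
    rcases hab.eq_or_lt with rfl | h | h
    · simp [transport_self]
    · simp [transport_of_lt w h, hg a ha b hb h]
    · simp [transport_of_gt w h, hg b hb a ha h]
  -- The value at a new cell is transported from an arbitrary neighbour `p x`; connectedness of the
  -- link makes the result independent of that choice.
  choose! p hp using fun x hx => (hl x hx).1
  have key : ∀ x ∈ B, ∀ a ∈ S, (a < x ∨ x < a) →
      g a * transport w a x = g (p x) * transport w (p x) x := by
    intro x hx a ha hax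
    refine ((hl x hx).2 (p x) (hp x hx) a ⟨ha, hax⟩).induction
      (p := fun a => g a * transport w a x = g (p x) * transport w (p x) x) rfl ?_
    rintro b ⟨hb, hbx⟩ c ⟨hc, hcx⟩ hbc h
    have hcx' : Incident c x := hcx.imp le_of_lt le_of_lt
    have hbx' : Incident b x := hbx.imp le_of_lt le_of_lt
    rw [← h, ← hg' b hb c hc hbc, mul_assoc,
      hw.transport_mul (Or.inl hb) (Or.inl hc) (Or.inr hx) hbc hcx' hbx']
  refine ⟨fun x => if x ∈ B then g (p x) * transport w (p x) x else g x, ?_⟩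
  rintro a (ha | ha) b (hb | hb) hab
  · have h1 : a ∉ B := fun h => hSB a h ha
    have h2 : b ∉ B := fun h => hSB b h hb
    simp only [h1, h2, if_false]
    exact hg a ha b hb hab
  · have h1 : a ∉ B := fun h => hSB a h ha
    simp only [h1, hb, if_false, if_true]
    rw [← key b hb a ha (Or.inl hab), transport_of_lt w hab]; group
  · have h1 : b ∉ B := fun h => hSB b h hb
    simp only [h1, ha, if_false, if_true]
    rw [← key a ha b hb (Or.inr hab), transport_of_gt w hab]; group
  · exact absurd hab (hB a ha b hb)

lemma HasPotentials.insert {x : C} (hS : HasPotentials G S) (hx : x ∉ S)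
    (hl : IsConnectedRegion {a | a ∈ S ∧ (a < x ∨ x < a)}) : HasPotentials G (insert x S) := by
  rw [← Set.union_singleton]
  exact hS.union (by simp) (by simpa using hx) (by rintro _ rfl; exact hl)

/-- The ordered product of the values of a cocycle along a path. -/
noncomputable def pathProd (w : C → C → G) : List C → G
  | [] => 1
  | [_] => 1
  | a :: b :: l => transport w a b * pathProd w (b :: l)

lemma pathProd_append (w : C → C → G) (p q : List C) (a : C) :
    pathProd w (p ++ a :: q) = pathProd w (p ++ [a]) * pathProd w (a :: q) := by
  induction p with
  | nil => simp [pathProd]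
  | cons b p ih =>
    cases p with
    | nil => simp [pathProd]
    | cons c p => simpa [pathProd, mul_assoc] using ih

lemma IsCocycleOn.pathProd_eq_of_homotopicIn {w : C → C → G} (hw : IsCocycleOn S w)
    {l l' : List C} (h : HomotopicIn S l l') : pathProd w l = pathProd w l' := by
  induction h with
  | rel _ _ h =>
    cases h with
    | triangle p q a b c ha hb hc hab hbc hac =>
      rw [pathProd_append, pathProd_append w p (c :: q)]
      simp only [pathProd, ← mul_assoc, ← hw.transport_mul ha hb hc hab hbc hac]
    | stutter p q a ha =>
      rw [pathProd_append, pathProd_append w p q]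
      simp [pathProd, transport_self]
  | refl => rfl
  | symm _ _ _ ih => exact ih.symm
  | trans _ _ _ _ _ ih ih' => exact ih.trans ih'

lemma Linked.exists_path {a b : C} (h : Linked S a b) (ha : a ∈ S) :
    ∃ l : List C, IsPathIn S (a :: (l ++ [b])) := by
  induction h with
  | refl => exact ⟨[], by simp [IsPathIn, ha, Incident]⟩
  | @tail b c _ h ih =>
    obtain ⟨l, hl⟩ := ih
    refine ⟨l ++ [b], ?_, ?_⟩
    · have := hl.1
      rw [← List.cons_append] at this ⊢
      rw [← List.cons_append, List.append_assoc]
      rw [List.isChain_append] at this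
      rw [List.isChain_append]
      refine ⟨this.1, by simp [h.2.2], ?_⟩
      simpa using this.2.2
    · have := hl.2
      simp only [List.mem_cons, List.mem_append, List.not_mem_nil, or_false] at this ⊢
      rintro x (hx | (hx | hx) | hx)
      · exact this x (Or.inl hx)
      · exact this x (Or.inr (Or.inl hx))
      · exact this x (Or.inr (Or.inr hx))
      · exact hx ▸ h.2.1

/-- The potential at a cell is the product of the cocycle along a chosen path from a base point;
products around closed paths are trivial because elementary moves preserve them. -/
lemma IsSimplyConnected.hasPotentials (hS : IsSimplyConnected S) : HasPotentials G S := by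
  intro w hw
  obtain ⟨⟨⟨o, ho⟩, hc⟩, hl⟩ := hS
  choose! p hp using fun x (hx : x ∈ S) => (hc o ho x hx).exists_path ho
  choose! q hq using fun x (hx : x ∈ S) => (hc x hx o ho).exists_path hx
  have key : ∀ x ∈ S, ∀ y ∈ S, Incident x y →
      pathProd w (o :: (p x ++ [x])) * transport w x y * pathProd w (y :: (q y ++ [o])) = 1 := by
    intro x hx y hy hxy
    have h1 := hl o (p x ++ x :: y :: q y) <| by
      have e : o :: ((p x ++ x :: y :: q y) ++ [o])
          = (o :: (p x ++ [x])) ++ (y :: (q y ++ [o])) := by simp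
      rw [e]
      refine ⟨?_, ?_⟩
      · rw [List.isChain_append]
        refine ⟨(hp x hx).1, (hq y hy).1, ?_⟩
        rw [← List.cons_append, List.getLast?_concat]
        simpa using hxy
      · intro z hz
        rcases List.mem_append.1 hz with hz | hz
        · exact (hp x hx).2 z hz
        · exact (hq y hy).2 z hz
    have h2 := hw.pathProd_eq_of_homotopicIn h1
    have e : o :: ((p x ++ x :: y :: q y) ++ [o])
          = (o :: p x) ++ (x :: y :: (q y ++ [o])) := by simp
    rw [e, pathProd_append] at h2
    simpa [pathProd, mul_assoc] using h2
  refine ⟨fun x => pathProd w (o :: (p x ++ [x])), fun a ha b hb hab => ?_⟩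
  have h1 := key a ha b hb (Or.inl hab.le)
  -- The degenerate step from `b` to itself has the same return path, which therefore cancels
  -- between the two identities.
  have h2 := key b hb b hb (Or.inl le_rfl)
  rw [transport_self, mul_one] at h2
  rw [← transport_of_lt w hab]
  simp only [← mul_right_cancel (h1.trans h2.symm)]
  group

end Potentials

end DiscreteSurface

namespace DiscreteSurface

/-! ### The fundamental group inside the monoid of path classes -/

section Corner

variable {M : Type*} [Monoid M]

/-- The elements `x = e * x * e` of a monoid, for an idempotent element `e`. -/
def Corner (e : {x : M // x * x = x}) : Type _ := {x : M // e.1 * x = x ∧ x * e.1 = x}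

instance (e : {x : M // x * x = x}) : Monoid (Corner e) where
  mul x y := ⟨x.1 * y.1, by rw [← mul_assoc, x.2.1], by rw [mul_assoc, y.2.2]⟩
  mul_assoc x y z := Subtype.ext (mul_assoc x.1 y.1 z.1)
  one := ⟨e.1, e.2, e.2⟩
  one_mul x := Subtype.ext x.2.1
  mul_one x := Subtype.ext x.2.2

lemma Corner.val_mul {e : {x : M // x * x = x}} (x y : Corner e) : (x * y).1 = x.1 * y.1 := rfl

lemma Corner.val_one {e : {x : M // x * x = x}} : (1 : Corner e).1 = e.1 := rfl

end Corner

section PathClasses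

variable {C : Type*} [PartialOrder C] {S : Set C}

lemma ElementaryMove.append {l l' : List C} (h : ElementaryMove S l l') (u v : List C) :
    ElementaryMove S (u ++ l ++ v) (u ++ l' ++ v) := by
  cases h with
  | triangle p q a b c ha hb hc hab hbc hac =>
    simpa using ElementaryMove.triangle (u ++ p) (q ++ v) a b c ha hb hc hab hbc hac
  | stutter p q a ha => simpa using ElementaryMove.stutter (u ++ p) (q ++ v) a ha

lemma HomotopicIn.append {l l' : List C} (h : HomotopicIn S l l') (u v : List C) :
    HomotopicIn S (u ++ l ++ v) (u ++ l' ++ v) := by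
  induction h with
  | rel _ _ h => exact .rel _ _ (h.append u v)
  | refl => exact .refl _
  | symm _ _ _ ih => exact .symm _ _ ih
  | trans _ _ _ _ _ ih ih' => exact .trans _ _ _ ih ih'

/-- Homotopy as a congruence on the free monoid of all lists of cells. -/
def pathCon (S : Set C) : Con (FreeMonoid C) where
  r l l' := HomotopicIn S l.toList l'.toList
  iseqv := Relation.EqvGen.is_equivalence _
  mul' {a b c d} h h' := by
    have h1 := HomotopicIn.append h [] c.toList
    have h2 := HomotopicIn.append h' b.toList []
    simp only [List.nil_append, List.append_nil] at h1 h2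
    exact .trans _ _ _ h1 h2

/-- The homotopy class of a list of cells. -/
def pathClass (S : Set C) (l : List C) : (pathCon S).Quotient := (FreeMonoid.ofList l : FreeMonoid C)

lemma pathClass_append (l l' : List C) :
    pathClass S (l ++ l') = pathClass S l * pathClass S l' := rfl

lemma pathClass_cons (a : C) (l : List C) :
    pathClass S (a :: l) = pathClass S [a] * pathClass S l := rfl

lemma pathClass_eq_iff {l l' : List C} : pathClass S l = pathClass S l' ↔ HomotopicIn S l l' :=
  Con.eq _

lemma pathClass_stutter {a : C} (ha : a ∈ S) :
    pathClass S [a] * pathClass S [a] = pathClass S [a] := by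
  rw [← pathClass_append, pathClass_eq_iff]
  exact .rel _ _ (.stutter [] [] a ha)

lemma pathClass_triangle {a b c : C} (ha : a ∈ S) (hb : b ∈ S) (hc : c ∈ S)
    (hab : Incident a b) (hbc : Incident b c) (hac : Incident a c) :
    pathClass S [a] * (pathClass S [b] * pathClass S [c]) = pathClass S [a] * pathClass S [c] := by
  rw [← pathClass_append, ← pathClass_append, ← pathClass_append, pathClass_eq_iff]
  exact .rel _ _ (.triangle [] [] a b c ha hb hc hab hbc hac)

lemma pathClass_backtrack {a b : C} (ha : a ∈ S) (hb : b ∈ S) (hab : Incident a b) :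
    pathClass S [a] * (pathClass S [b] * pathClass S [a]) = pathClass S [a] := by
  rw [pathClass_triangle ha hb ha hab hab.symm (Or.inl le_rfl), pathClass_stutter ha]

/-- The witnesses are the classes of a path from `o` to `x` and of its reverse. Since `[x]` is
idempotent, concatenation at a common end point is the monoid product, and the two classes are
inverse to each other relative to the local units `[o]` and `[x]`. -/
lemma Linked.exists_pathClass {o x : C} (ho : o ∈ S) (h : Linked S o x) :
    ∃ p q : (pathCon S).Quotient, p * q = pathClass S [o] ∧ q * p = pathClass S [x] ∧
      pathClass S [o] * p = p ∧ q * pathClass S [o] = q ∧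
      p * pathClass S [x] = p ∧ pathClass S [x] * q = q := by
  induction h with
  | refl => exact ⟨pathClass S [o], pathClass S [o], by simp [pathClass_stutter ho]⟩
  | @tail x y _ h ih =>
    obtain ⟨p, q, h1, h2, h3, h4, h5, h6⟩ := ih
    have e : ∀ r, pathClass S [x] * (pathClass S [y] * (pathClass S [x] * r)) =
        pathClass S [x] * r := fun r => by
      simpa only [mul_assoc] using congrArg (· * r) (pathClass_backtrack h.1 h.2.1 h.2.2)
    have sy := pathClass_stutter h.2.1
    have sy' : ∀ r, pathClass S [y] * (pathClass S [y] * r) = pathClass S [y] * r := fun r => by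
      rw [← mul_assoc, sy]
    refine ⟨p * pathClass S [y], pathClass S [y] * q, ?_, ?_, ?_, ?_, ?_, ?_⟩
    · rw [← h1, mul_assoc, sy']
      conv_lhs => rw [← h5, ← h6, mul_assoc, e, h6]
    · rw [mul_assoc, ← mul_assoc q, h2, pathClass_backtrack h.2.1 h.1 h.2.2.symm]
    · rw [← mul_assoc, h3]
    · rw [mul_assoc, h4]
    · rw [mul_assoc, sy]
    · rw [← mul_assoc, sy]

end PathClasses

section

universe u

variable {C : Type u} [PartialOrder C] {S : Set C}

/-- A connected region is simply connected if all homomorphisms from its fundamental groupoid to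
groups are trivial. -/
lemma isSimplyConnected_of_hasPotentials (hc : IsConnectedRegion S)
    (h : ∀ (G : Type u) [Group G], HasPotentials G S) : IsSimplyConnected S := by
  refine ⟨hc, fun o l hl => ?_⟩
  have ho : o ∈ S := hl.2 o (by simp)
  choose! p q h1 h2 h3 h4 _ h6 using fun x (hx : x ∈ S) => (hc.2 o ho x hx).exists_pathClass ho
  obtain ⟨k, hk⟩ : ∃ k : C → (pathCon S).Quotient, ∀ x, pathClass S [x] = k x :=
    ⟨_, fun _ => rfl⟩
  have hkk : ∀ x ∈ S, k x * k x = k x := fun x hx => hk x ▸ pathClass_stutter hx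
  have hkk' : ∀ x ∈ S, ∀ r, k x * (k x * r) = k x * r := fun x hx r => by
    rw [← mul_assoc, hkk x hx]
  have htri : ∀ x ∈ S, ∀ y ∈ S, ∀ z ∈ S, Incident x y → Incident y z → Incident x z → ∀ r,
      k x * (k y * (k z * r)) = k x * (k z * r) := fun x hx y hy z hz hxy hyz hxz r => by
    have := pathClass_triangle hx hy hz hxy hyz hxz
    simp only [hk] at this
    rw [← mul_assoc (k y), ← mul_assoc, this, mul_assoc]
  simp only [hk] at h1 h2 h3 h4 h6
  have h2' : ∀ x ∈ S, ∀ r, q x * (p x * r) = k x * r := fun x hx r => by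
    rw [← mul_assoc, h2 x hx]
  let e : {x : (pathCon S).Quotient // x * x = x} := ⟨k o, hkk o ho⟩
  have hmem : ∀ x ∈ S, ∀ y ∈ S, k o * (p x * (k x * (k y * q y))) = p x * (k x * (k y * q y)) ∧
      p x * (k x * (k y * q y)) * k o = p x * (k x * (k y * q y)) := fun x hx y hy => by
    refine ⟨by rw [← mul_assoc, h3 x hx], by simp only [mul_assoc, h4 y hy]⟩
  classical
  -- The closed path that goes from `o` to `x`, steps to `y` and returns to `o`; `[o]` is the unit
  -- of the corner monoid.
  let loop : C → C → Corner e := fun x y =>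
    if hxy : x ∈ S ∧ y ∈ S then ⟨p x * (k x * (k y * q y)), hmem x hxy.1 y hxy.2⟩ else 1
  have loop_val : ∀ x ∈ S, ∀ y ∈ S, (loop x y).1 = p x * (k x * (k y * q y)) :=
    fun x hx y hy => congrArg Subtype.val (dif_pos (⟨hx, hy⟩ : x ∈ S ∧ y ∈ S))
  have loop_mul : ∀ x ∈ S, ∀ y ∈ S, ∀ z ∈ S, Incident x y → Incident y z → Incident x z →
      loop x y * loop y z = loop x z := fun x hx y hy z hz hxy hyz hxz => by
    apply Subtype.ext
    rw [Corner.val_mul, loop_val x hx y hy, loop_val y hy z hz, loop_val x hx z hz]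
    simp only [mul_assoc, h2' y hy, hkk' y hy]
    rw [htri x hx y hy z hz hxy hyz hxz]
  have loop_self : ∀ x ∈ S, loop x x = 1 := fun x hx => by
    apply Subtype.ext
    rw [loop_val x hx x hx, Corner.val_one, hkk' x hx, h6 x hx, h1 x hx]
  -- Backtracking makes `loop y x` inverse to `loop x y`. The units thus form a group carrying a
  -- tautological cocycle, and its potential controls all closed paths.
  let w : C → C → (Corner e)ˣ := fun x y =>
    if hxy : x ∈ S ∧ y ∈ S ∧ Incident x y then
      ⟨loop x y, loop y x,
        by rw [loop_mul x hxy.1 y hxy.2.1 x hxy.1 hxy.2.2 hxy.2.2.symm (Or.inl le_rfl),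
          loop_self x hxy.1],
        by rw [loop_mul y hxy.2.1 x hxy.1 y hxy.2.1 hxy.2.2.symm hxy.2.2 (Or.inl le_rfl),
          loop_self y hxy.2.1]⟩
    else 1
  have w_val : ∀ x ∈ S, ∀ y ∈ S, Incident x y → (w x y).1 = loop x y :=
    fun x hx y hy hxy => by simp only [w, hx, hy, hxy, and_self, dif_pos]
  obtain ⟨g, hg⟩ := h (Corner e)ˣ w fun a ha b hb c hc hab hbc => by
    have hac := hab.trans hbc
    apply Units.ext
    rw [Units.val_mul, w_val a ha b hb (Or.inl hab.le), w_val b hb c hc (Or.inl hbc.le),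
      w_val a ha c hc (Or.inl hac.le)]
    exact loop_mul a ha b hb c hc (Or.inl hab.le) (Or.inl hbc.le) (Or.inl hac.le)
  have hg' : ∀ a ∈ S, ∀ b ∈ S, Incident a b → ((g a)⁻¹ * g b).1 = loop a b := by
    intro a ha b hb hab
    rcases hab.eq_or_lt with rfl | hlt | hlt
    · rw [inv_mul_cancel, loop_self a ha, Units.val_one]
    · rw [← hg a ha b hb hlt, w_val a ha b hb hab]
    · have : (g a)⁻¹ * g b = (w b a)⁻¹ := by rw [hg b hb a ha hlt]; group
      rw [this]
      simp only [w, hb, ha, hab.symm, and_self, dif_pos]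
      rfl
  -- The potential telescopes along a path, so it computes the class of the path closed up through
  -- the base point.
  have key : ∀ (l : List C) (x y : C), IsPathIn S (x :: (l ++ [y])) →
      ((g x)⁻¹ * g y).1.1 = p x * (pathClass S (x :: (l ++ [y])) * q y) := by
    intro l
    induction l with
    | nil =>
      intro x y hxy
      have hx : x ∈ S := hxy.2 x (by simp)
      have hy : y ∈ S := hxy.2 y (by simp)
      have hi : Incident x y := by simpa using hxy.1
      rw [hg' x hx y hy hi, loop_val x hx y hy, List.nil_append, pathClass_cons, hk, hk, mul_assoc]
    | cons z l ih =>
      intro x y hxy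
      have hx : x ∈ S := hxy.2 x (by simp)
      have hz : z ∈ S := hxy.2 z (by simp)
      have hi : Incident x z := (List.isChain_cons_cons.1 hxy.1).1
      have hzy : IsPathIn S (z :: (l ++ [y])) :=
        ⟨(List.isChain_cons_cons.1 hxy.1).2, fun t ht => hxy.2 t (List.mem_cons_of_mem _ ht)⟩
      have e1 : (g x)⁻¹ * g y = ((g x)⁻¹ * g z) * ((g z)⁻¹ * g y) := by group
      rw [e1, Units.val_mul, Corner.val_mul, ih z y hzy, hg' x hx z hz hi, loop_val x hx z hz,
        List.cons_append, pathClass_cons x, pathClass_cons z]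
      simp only [mul_assoc]
      rw [h2' z hz]
      simp only [hk, hkk' z hz]
  have h7 := key l o o hl
  rw [inv_mul_cancel, Units.val_one, Corner.val_one] at h7
  rw [← pathClass_eq_iff, hk]
  have h8 : pathClass S (o :: (l ++ [o])) = k o * pathClass S (o :: (l ++ [o])) * k o := by
    have : pathClass S (o :: (l ++ [o])) = k o * (pathClass S l * k o) := by
      rw [pathClass_cons, pathClass_append, hk]
    rw [this]
    simp only [mul_assoc, hkk' o ho, hkk o ho]
  have h9 : q o * k o * p o = k o := by rw [h4 o ho, h2 o ho]
  calc pathClass S (o :: (l ++ [o]))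
      = q o * (p o * (pathClass S (o :: (l ++ [o])) * q o)) * p o := by
        rw [← mul_assoc, h2 o ho, ← mul_assoc, mul_assoc _ (q o), h2 o ho]
        exact h8
    _ = k o := by rw [← h7, h9]

end

end DiscreteSurface

namespace DiscreteSurface

namespace ClosedSurface

/-! ### Incidence in a closed surface -/

section Basic

variable {C : Type*} [PartialOrder C] (M : ClosedSurface C)

lemma dim_eq_one_of_lt_of_lt {a b c : C} (hab : a < b) (hbc : b < c) : M.dim b = 1 := by
  have h1 := M.dim_strictMono hab
  have h2 := M.dim_strictMono hbc
  have h3 := M.dim_le_two c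
  omega

lemma dim_eq_two_of_lt {e f : C} (he : M.dim e = 1) (h : e < f) : M.dim f = 2 := by
  have h1 := M.dim_strictMono h
  have h3 := M.dim_le_two f
  omega

lemma dim_eq_zero_of_lt {v e : C} (he : M.dim e = 1) (h : v < e) : M.dim v = 0 := by
  have h1 := M.dim_strictMono h
  omega

lemma dim_eq_one_or_two_of_lt {a b : C} (h : a < b) : M.dim b = 1 ∨ M.dim b = 2 := by
  have h1 := M.dim_strictMono h
  have h3 := M.dim_le_two b
  omega

lemma exists_faces {e : C} (he : M.dim e = 1) :
    ∃ f₁ f₂, f₁ ≠ f₂ ∧ ∀ f, e < f ↔ f = f₁ ∨ f = f₂ := by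
  obtain ⟨f₁, f₂, hne, h⟩ := Set.ncard_eq_two.1 (M.edge_faces e he)
  exact ⟨f₁, f₂, hne, fun f => by simpa using Set.ext_iff.1 h f⟩

lemma exists_ends {e : C} (he : M.dim e = 1) :
    ∃ v₁ v₂, v₁ ≠ v₂ ∧ ∀ v, v < e ↔ v = v₁ ∨ v = v₂ := by
  obtain ⟨f₁, f₂, hne, h⟩ := Set.ncard_eq_two.1 (M.edge_vertices e he)
  exact ⟨f₁, f₂, hne, fun f => by simpa using Set.ext_iff.1 h f⟩

lemma exists_corner_edges {v f : C} (hv : M.dim v = 0) (hf : M.dim f = 2) (h : v < f) :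
    ∃ e₁ e₂, e₁ ≠ e₂ ∧ ∀ e, v < e ∧ e < f ↔ e = e₁ ∨ e = e₂ := by
  obtain ⟨f₁, f₂, hne, h⟩ := Set.ncard_eq_two.1 (M.corner_edges v f hv hf h)
  exact ⟨f₁, f₂, hne, fun f => by simpa using Set.ext_iff.1 h f⟩

lemma exists_face_ge (c : C) : ∃ f, c ≤ f ∧ M.dim f = 2 := by
  have edge : ∀ e, M.dim e = 1 → ∃ f, e ≤ f ∧ M.dim f = 2 := fun e he => by
    obtain ⟨f, _, _, h⟩ := M.exists_faces he
    have hf := (h f).2 (Or.inl rfl)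
    exact ⟨f, hf.le, M.dim_eq_two_of_lt he hf⟩
  have h3 := M.dim_le_two c
  interval_cases h : M.dim c
  · obtain ⟨d, hd⟩ := (M.vertex_star_connected c h).1
    rcases M.dim_eq_one_or_two_of_lt hd with h1 | h2
    · obtain ⟨f, hf, hf2⟩ := edge d h1
      exact ⟨f, (le_of_lt hd).trans hf, hf2⟩
    · exact ⟨d, le_of_lt hd, h2⟩
  · exact edge c h
  · exact ⟨c, le_rfl, h⟩

end Basic

/-! ### Mod 2 cochains and even edge sets -/

section Cochains

open Classical

variable {C : Type*} [PartialOrder C] [Fintype C] (M : ClosedSurface C)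

/-- The sum mod 2 of a function on the faces over the two sides of an edge. -/
noncomputable def sideSum (g : C → ZMod 2) (e : C) : ZMod 2 := ∑ f with e < f, g f

/-- The sum mod 2 of a function on the edges over the edges that end at a vertex. -/
noncomputable def starSum (ω : C → ZMod 2) (v : C) : ZMod 2 := ∑ e with v < e ∧ M.dim e = 1, ω e

variable {M}

lemma sideSum_eq {g : C → ZMod 2} {e f₁ f₂ : C} (hne : f₁ ≠ f₂)
    (h : ∀ f, e < f ↔ f = f₁ ∨ f = f₂) : sideSum g e = g f₁ + g f₂ := by
  have : (Finset.univ.filter fun f => e < f) = {f₁, f₂} := by ext f; simp [h]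
  rw [sideSum, this, Finset.sum_pair hne]

lemma sideSum_eq_zero_iff {g : C → ZMod 2} {e : C} (he : M.dim e = 1) :
    sideSum g e = 0 ↔ ∀ f f', e < f → e < f' → g f = g f' := by
  obtain ⟨f₁, f₂, hne, h⟩ := M.exists_faces he
  rw [sideSum_eq hne h, CharTwo.add_eq_zero]
  simp only [h]
  constructor
  · rintro h' f f' (rfl | rfl) (rfl | rfl) <;> simp [h']
  · exact fun h' => h' _ _ (Or.inl rfl) (Or.inr rfl)

lemma sideSum_eq_add {g : C → ZMod 2} {e f f' : C} (he : M.dim e = 1) (hf : e < f) (hf' : e < f')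
    (hne : f ≠ f') : sideSum g e = g f + g f' := by
  obtain ⟨f₁, f₂, hne', h⟩ := M.exists_faces he
  rw [sideSum_eq hne' h]
  rcases (h f).1 hf with rfl | rfl <;> rcases (h f').1 hf' with rfl | rfl
  · exact absurd rfl hne
  · rfl
  · exact add_comm _ _
  · exact absurd rfl hne

/-- Each face around `v` is counted twice, once for each of its two edges ending at `v`. -/
lemma starSum_sideSum {v : C} (hv : M.dim v = 0) (g : C → ZMod 2) :
    M.starSum (sideSum g) v = 0 := by
  unfold starSum sideSum
  rw [Finset.sum_comm' (s' := fun f => Finset.univ.filter fun e => v < e ∧ e < f)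
    (t' := Finset.univ.filter fun f => v < f ∧ M.dim f = 2)]
  · refine Finset.sum_eq_zero fun f hf => ?_
    obtain ⟨hvf, hf⟩ := (Finset.mem_filter.1 hf).2
    obtain ⟨e₁, e₂, hne, h⟩ := M.exists_corner_edges hv hf hvf
    have : (Finset.univ.filter fun e => v < e ∧ e < f) = {e₁, e₂} := by ext e; simp [h]
    rw [this, Finset.sum_pair hne, CharTwo.add_self_eq_zero]
  · intro e f
    simp only [Finset.mem_filter, Finset.mem_univ, true_and]
    constructor
    · rintro ⟨⟨h1, h2⟩, h3⟩
      exact ⟨⟨h1, h3⟩, h1.trans h3, M.dim_eq_two_of_lt h2 h3⟩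
    · rintro ⟨⟨h1, h2⟩, _, _⟩
      exact ⟨⟨h1, M.dim_eq_one_of_lt_of_lt h1 h2⟩, h2⟩

lemma starSum_add (ω ω' : C → ZMod 2) (v : C) :
    M.starSum (ω + ω') v = M.starSum ω v + M.starSum ω' v := by
  simp [starSum, Finset.sum_add_distrib]

lemma starSum_single {e : C} (he : M.dim e = 1) (v : C) :
    M.starSum (Pi.single e 1) v = if v < e then 1 else 0 := by
  unfold starSum
  simp [Pi.single_apply, he]

/-- The star of a vertex is strongly connected. -/
lemma eq_of_star {v : C} (hv : M.dim v = 0) {g : C → ZMod 2}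
    (h : ∀ e, v < e → M.dim e = 1 → sideSum g e = 0) {f f' : C} (hf : v < f) (hf' : v < f')
    (hd : M.dim f = 2) (hd' : M.dim f' = 2) : g f' = g f := by
  -- The claim is carried along the path for all faces above the current cell; only a step down from
  -- a face to an edge uses that `g` does not jump there.
  refine ((M.vertex_star_connected v hv).2 f hf f' hf').induction
    (p := fun c => ∀ f', M.dim f' = 2 → c ≤ f' → g f' = g f) ?_ ?_ f' hd' le_rfl
  · intro f' hd' hle
    rcases hle.eq_or_lt with rfl | hlt
    · rfl
    · have := M.dim_strictMono hlt
      omega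
  · intro x hx y hy hxy ih f' hd' hf'
    rcases hxy.eq_or_lt with rfl | hxy | hxy
    · exact ih f' hd' hf'
    · exact ih f' hd' (hxy.le.trans hf')
    · have h1 := M.dim_eq_one_of_lt_of_lt hy hxy
      have hlt : y < f' := lt_of_le_of_ne hf' (by rintro rfl; omega)
      rw [(sideSum_eq_zero_iff h1).1 (h y hy h1) f' x hlt hxy]
      exact ih x (M.dim_eq_two_of_lt h1 hxy) le_rfl

/-- The star of a vertex stays strongly connected if one edge is removed. -/
lemma eq_of_star_of_ne {v e₀ : C} (hv : M.dim v = 0) (he₀ : v < e₀) (hd₀ : M.dim e₀ = 1)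
    {g : C → ZMod 2} (h : ∀ e, v < e → M.dim e = 1 → e ≠ e₀ → sideSum g e = 0) {f f' : C}
    (hf : v < f) (hf' : v < f') (hd : M.dim f = 2) (hd' : M.dim f' = 2) : g f' = g f := by
  refine eq_of_star hv (fun e he hd => ?_) hf hf' hd hd'
  by_cases hee : e = e₀
  · subst hee
    -- The jumps around a vertex sum to zero, so a single exceptional edge cannot have a jump.
    have := starSum_sideSum hv g
    unfold starSum at this
    rwa [Finset.sum_eq_single_of_mem e (by simp [he, hd])] at this
    intro b hb hne
    simp only [Finset.mem_filter, Finset.mem_univ, true_and] at hb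
    exact h b hb.1 hb.2 hne
  · exact h e he hd hee

/-- A function on the faces that does not change across the edges of a connected open region is
constant on the region. -/
lemma eq_of_isPreconnectedRegion {U : Set C} (hU : IsUpperSet U) (hc : IsPreconnectedRegion U)
    {g : C → ZMod 2} (h : ∀ e ∈ U, M.dim e = 1 → sideSum g e = 0) {f f' : C} (hf : f ∈ U)
    (hf' : f' ∈ U) (hd : M.dim f = 2) (hd' : M.dim f' = 2) : g f' = g f := by
  refine (hc f hf f' hf').induction
    (p := fun c => ∀ f', M.dim f' = 2 → c ≤ f' → g f' = g f) ?_ ?_ f' hd' le_rfl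
  · intro f' hd' hle
    rcases hle.eq_or_lt with rfl | hlt
    · rfl
    · have := M.dim_strictMono hlt
      omega
  · intro x hx y hy hxy ih f' hd' hf'
    rcases hxy.eq_or_lt with rfl | hxy | hxy
    · exact ih f' hd' hf'
    · exact ih f' hd' (hxy.le.trans hf')
    · obtain ⟨f₀, hf₀, hd₀⟩ := M.exists_face_ge x
      rw [← ih f₀ hd₀ hf₀]
      have hyd : M.dim y < 2 := by
        have := M.dim_strictMono hxy
        have := M.dim_le_two x
        omega
      have hlt : y < f' := lt_of_le_of_ne hf' (by rintro rfl; omega)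
      have hlt₀ : y < f₀ := hxy.trans_le hf₀
      interval_cases h1 : M.dim y
      · exact eq_of_star h1 (fun e he hd => h e (hU he.le hy) hd) hlt₀ hlt hd₀ hd'
      · exact (sideSum_eq_zero_iff h1).1 (h y hy h1) f' f₀ hlt hlt₀

/-- On the star of a vertex every even set of edges is a coboundary. -/
lemma exists_sideSum_eq_of_starSum_eq_zero {v : C} (hv : M.dim v = 0) {ω : C → ZMod 2}
    (hω : M.starSum ω v = 0) :
    ∃ g : C → ZMod 2, ∀ e, v < e → M.dim e = 1 → sideSum g e = ω e := by
  -- `A` is the transpose of `sideSum` on the star. Its kernel consists of functions constant on the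
  -- edges at `v`, which pair to zero with the even set `ω`; duality then puts `ω` in the image of
  -- `sideSum`.
  let A : (C → ZMod 2) →ₗ[ZMod 2] (C → ZMod 2) :=
    { toFun := fun y f => if v < f ∧ M.dim f = 2 then ∑ e with v < e ∧ e < f, y e else 0
      map_add' := fun y z => by
        ext f
        by_cases hf : v < f ∧ M.dim f = 2 <;> simp [hf, Finset.sum_add_distrib]
      map_smul' := fun r y => by
        ext f
        by_cases hf : v < f ∧ M.dim f = 2 <;> simp [hf, Finset.mul_sum] }
  have hA : ∀ y f, A y f = if v < f ∧ M.dim f = 2 then ∑ e with v < e ∧ e < f, y e else 0 :=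
    fun _ _ => rfl
  let φ : Module.Dual (ZMod 2) (C → ZMod 2) :=
    ∑ e with v < e ∧ M.dim e = 1, ω e • LinearMap.proj e
  have hφ : ∀ y, φ y = ∑ e with v < e ∧ M.dim e = 1, ω e * y e := fun y => by
    simp [φ, LinearMap.sum_apply]
  have hmem : φ ∈ (LinearMap.ker A).dualAnnihilator := by
    rw [Submodule.mem_dualAnnihilator]
    intro y hy
    have hconst : ∀ e e', v < e → M.dim e = 1 → v < e' → M.dim e' = 1 → y e' = y e := by
      intro e e' he hd he' hd'
      refine ((M.vertex_star_connected v hv).2 e he e' he').induction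
        (p := fun c => ∀ e', v < e' → M.dim e' = 1 → e' ≤ c → y e' = y e) ?_ ?_ e' he' hd' le_rfl
      · intro e' he' hd' hle
        rcases hle.eq_or_lt with rfl | hlt
        · rfl
        · have := M.dim_strictMono hlt
          omega
      · intro a ha b hb hab ih e' he' hd' hle
        rcases hab.eq_or_lt with rfl | hab | hab
        · exact ih e' he' hd' hle
        · have hda := M.dim_eq_one_of_lt_of_lt ha hab
          have hdb := M.dim_eq_two_of_lt hda hab
          have hlt : e' < b := lt_of_le_of_ne hle (by rintro rfl; omega)
          rw [← ih a ha hda le_rfl]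
          obtain ⟨e₁, e₂, hne, h⟩ := M.exists_corner_edges hv hdb hb
          have h2 : A y b = 0 := by rw [LinearMap.mem_ker.1 hy]; rfl
          have : (Finset.univ.filter fun e => v < e ∧ e < b) = {e₁, e₂} := by ext e; simp [h]
          rw [hA, if_pos ⟨hb, hdb⟩, this, Finset.sum_pair hne, CharTwo.add_eq_zero] at h2
          rcases (h a).1 ⟨ha, hab⟩ with rfl | rfl <;>
            rcases (h e').1 ⟨he', hlt⟩ with rfl | rfl <;> simp [h2]
        · exact ih e' he' hd' (hle.trans hab.le)
    rw [hφ]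
    by_cases hne : ∃ e, v < e ∧ M.dim e = 1
    · obtain ⟨e₀, he₀, hd₀⟩ := hne
      rw [Finset.sum_congr rfl (g := fun e => ω e * y e₀), ← Finset.sum_mul]
      · change M.starSum ω v * _ = 0
        rw [hω, zero_mul]
      · intro e he
        simp only [Finset.mem_filter, Finset.mem_univ, true_and] at he
        rw [hconst e₀ e he₀ hd₀ he.1 he.2]
    · refine Finset.sum_eq_zero fun e he => ?_
      simp only [Finset.mem_filter, Finset.mem_univ, true_and] at he
      exact absurd ⟨e, he⟩ hne
  rw [← LinearMap.range_dualMap_eq_dualAnnihilator_ker] at hmem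
  obtain ⟨ψ, hψ⟩ := hmem
  refine ⟨fun f => ψ (Pi.single f 1), fun e he hd => ?_⟩
  have h1 : φ (Pi.single e 1) = ω e := by
    rw [hφ]
    simp [Pi.single_apply, he, hd]
  rw [← h1, ← hψ, LinearMap.dualMap_apply, sideSum, ← map_sum]
  congr 1
  ext f
  rw [hA, Finset.sum_apply]
  simp only [Pi.single_apply, Finset.sum_ite_eq, Finset.sum_ite_eq', Finset.mem_filter,
    Finset.mem_univ, true_and]
  by_cases hef : e < f
  · simp [hef, he, he.trans hef, M.dim_eq_two_of_lt hd hef]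
  · simp [hef]

/-- If the surface has no nontrivial double covers, then every even set of edges is the boundary
mod 2 of a set of faces. -/
lemma exists_sideSum_eq (hM : HasPotentials (Multiplicative (ZMod 2)) (Set.univ : Set C))
    {ω : C → ZMod 2} (hω : ∀ v, M.dim v = 0 → M.starSum ω v = 0) :
    ∃ g : C → ZMod 2, ∀ e, M.dim e = 1 → sideSum g e = ω e := by
  choose! γ hγ using fun v (hv : M.dim v = 0) => exists_sideSum_eq_of_starSum_eq_zero hv (hω v hv)
  have hφ : ∀ e, M.dim e = 1 → ∃ f, e < f := fun e he => by
    obtain ⟨f, _, _, h⟩ := M.exists_faces he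
    exact ⟨f, (h f).2 (Or.inl rfl)⟩
  choose! φ hφ using hφ
  -- The cocycle of the double cover whose sheets are exchanged across the edges with `ω = 1`. Each
  -- edge is attached to the sheets so that the exchange happens on the side of its chosen face `φ
  -- e`; the local solutions `γ` give the values at vertices.
  let w : C → C → ZMod 2 := fun a b =>
    if M.dim a = 0 then if M.dim b = 2 then γ a b else γ a (φ b) + ω b
    else if b = φ a then ω a else 0
  obtain ⟨g, hg⟩ := hM (fun a b => Multiplicative.ofAdd (w a b)) <| by
    intro a _ b _ c _ hab hbc
    have hb := M.dim_eq_one_of_lt_of_lt hab hbc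
    have ha := M.dim_eq_zero_of_lt hb hab
    have hc := M.dim_eq_two_of_lt hb hbc
    rw [← ofAdd_add]
    congr 1
    simp only [w, ha, hb, hc, if_true, one_ne_zero, if_false, OfNat.one_ne_ofNat]
    split_ifs with h
    · rw [h, add_assoc, CharTwo.add_self_eq_zero, add_zero]
    · rw [add_zero, ← hγ a ha b hab hb, sideSum_eq_add hb (hφ b hb) hbc (Ne.symm h), ← add_assoc,
        CharTwo.add_self_eq_zero, zero_add]
  refine ⟨fun c => (g c).toAdd, fun e he => ?_⟩
  obtain ⟨f₁, f₂, hne, h⟩ := M.exists_faces he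
  have key : ∀ f, e < f → (g f).toAdd = w e f + (g e).toAdd := fun f hf => by
    have := hg e trivial f trivial hf
    have h2 := congrArg Multiplicative.toAdd this
    simp only [toAdd_ofAdd, toAdd_mul, toAdd_inv] at h2
    rw [h2]
    abel
  have h1 := (h f₁).2 (Or.inl rfl)
  have h2 := (h f₂).2 (Or.inr rfl)
  rw [sideSum_eq hne h, key f₁ h1, key f₂ h2]
  have h3 : w e f₁ + w e f₂ = ω e := by
    simp only [w, he, one_ne_zero, if_false]
    rcases (h _).1 (hφ e he) with h4 | h4
    · simp [h4, hne.symm]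
    · simp [h4, hne]
  rw [← h3, add_add_add_comm, CharTwo.add_self_eq_zero, add_zero]

end Cochains

end ClosedSurface

end DiscreteSurface

namespace DiscreteSurface

namespace ClosedSurface

/-! ### Trees and their complements -/

section Trees

variable {C : Type*} [PartialOrder C] (M : ClosedSurface C)

lemma exists_vertex_le (c : C) : ∃ v, v ≤ c ∧ M.dim v = 0 := by
  have edge : ∀ e, M.dim e = 1 → ∃ v, v ≤ e ∧ M.dim v = 0 := fun e he => by
    obtain ⟨v, _, _, h⟩ := M.exists_ends he
    have hv := (h v).2 (Or.inl rfl)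
    exact ⟨v, hv.le, M.dim_eq_zero_of_lt he hv⟩
  have h3 := M.dim_le_two c
  interval_cases h : M.dim c
  · exact ⟨c, le_rfl, h⟩
  · exact edge c h
  · obtain ⟨d, hd⟩ := (M.face_boundary_connected c h).1
    have hlt := M.dim_strictMono hd
    rw [h] at hlt
    interval_cases h1 : M.dim d
    · exact ⟨d, le_of_lt hd, h1⟩
    · obtain ⟨v, hv, hv0⟩ := edge d h1
      exact ⟨v, hv.trans (le_of_lt hd), hv0⟩

/-- A set of cells arises from `B` by successively adding edges with one new end point. -/
inductive TreeGrowth (B : Set C) : Set C → Prop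
  | refl : TreeGrowth B B
  | step {T : Set C} {e u v : C} (hT : TreeGrowth B T) (he : M.dim e = 1) (hu : u < e) (hv : v < e)
      (huT : u ∈ T) (hvT : v ∉ T) : TreeGrowth B (insert e (insert v T))

variable {M}

lemma eq_of_le_of_dim_eq_zero {x v : C} (hv : M.dim v = 0) (h : x ≤ v) : x = v := by
  rcases h.eq_or_lt with h | h
  · exact h
  · have := M.dim_strictMono h
    omega

lemma lt_iff_of_ends {e u v : C} (he : M.dim e = 1) (hu : u < e) (hv : v < e) (huv : u ≠ v)
    {x : C} : x < e ↔ x = u ∨ x = v := by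
  obtain ⟨a, b, hab, h⟩ := M.exists_ends he
  rw [h]
  rcases (h u).1 hu with rfl | rfl <;> rcases (h v).1 hv with rfl | rfl <;>
    simp_all [or_comm]

namespace TreeGrowth

variable {B T : Set C}

lemma trans {T' : Set C} (h : M.TreeGrowth B T) (h' : M.TreeGrowth T T') : M.TreeGrowth B T' := by
  induction h' with
  | refl => exact h
  | step _ he hu hv huT hvT ih => exact ih.step he hu hv huT hvT

lemma subset (h : M.TreeGrowth B T) : B ⊆ T := by
  induction h with
  | refl => exact subset_rfl
  | step _ _ _ _ _ _ ih => exact fun x hx => Or.inr (Or.inr (ih hx))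

lemma isLowerSet (h : M.TreeGrowth B T) (hB : IsLowerSet B) : IsLowerSet T := by
  induction h with
  | refl => exact hB
  | @step T e u v _ he hu hv huT hvT ih =>
    rintro y x hxy (rfl | rfl | hy)
    · rcases hxy.eq_or_lt with rfl | hlt
      · exact Or.inl rfl
      · rcases (lt_iff_of_ends he hu hv (by rintro rfl; exact hvT huT)).1 hlt with rfl | rfl
        · exact Or.inr (Or.inr huT)
        · exact Or.inr (Or.inl rfl)
    · exact Or.inr (Or.inl (eq_of_le_of_dim_eq_zero (M.dim_eq_zero_of_lt he hv) hxy))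
    · exact Or.inr (Or.inr (ih hxy hy))

lemma dim_le_one (h : M.TreeGrowth B T) (hB : ∀ c ∈ B, M.dim c ≤ 1) : ∀ c ∈ T, M.dim c ≤ 1 := by
  induction h with
  | refl => exact hB
  | @step T e u v _ he hu hv huT hvT ih =>
    rintro c (rfl | rfl | hc)
    · exact he.le
    · rw [M.dim_eq_zero_of_lt he hv]; exact zero_le_one
    · exact ih c hc

end TreeGrowth

lemma isLowerSet_singleton {o : C} (ho : M.dim o = 0) : IsLowerSet ({o} : Set C) := by
  rintro y x hxy rfl
  exact eq_of_le_of_dim_eq_zero ho hxy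

/-- There is a maximal tree in a region. -/
lemma exists_maximal_treeGrowth [Finite C] {B K : Set C} (hBK : B ⊆ K) (hK : IsLowerSet K) :
    ∃ T, M.TreeGrowth B T ∧ T ⊆ K ∧
      ∀ e ∈ K, M.dim e = 1 → ∀ u v, u < e → v < e → u ∈ T → v ∈ T := by
  obtain ⟨T, -, hT⟩ := Finite.exists_le_maximal (p := fun T => M.TreeGrowth B T ∧ T ⊆ K)
    ⟨TreeGrowth.refl (M := M) (B := B), hBK⟩
  refine ⟨T, hT.prop.1, hT.prop.2, fun e heK he u v hu hv huT => ?_⟩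
  by_contra hvT
  have h1 : insert e (insert v T) ⊆ T := hT.le_of_ge
    ⟨hT.prop.1.step he hu hv huT hvT, by
      rintro x (rfl | rfl | hx)
      · exact heK
      · exact hK hv.le heK
      · exact hT.prop.2 hx⟩ fun x hx => Or.inr (Or.inr hx)
  exact hvT (h1 (Or.inr (Or.inl rfl)))

/-- A set of vertices of a connected closed region that contains with one end point of an edge also
the other one contains all the vertices if it is non-empty. -/
lemma mem_of_isPreconnectedRegion {K W : Set C} (hK : IsLowerSet K)
    (hc : IsPreconnectedRegion K)
    (hW : ∀ e ∈ K, M.dim e = 1 → ∀ u v, u < e → v < e → u ∈ W → v ∈ W) {o v : C} (ho : o ∈ K)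
    (hd : M.dim o = 0) (hoW : o ∈ W) (hv : v ∈ K) (hvd : M.dim v = 0) : v ∈ W := by
  refine (hc o ho v hv).induction (p := fun c => ∀ v, M.dim v = 0 → v ≤ c → v ∈ W) ?_ ?_ v hvd
    le_rfl
  · rintro v - hle
    rwa [eq_of_le_of_dim_eq_zero hd hle]
  · intro x hx y hy hxy ih v hvd hle
    rcases hxy.eq_or_lt with rfl | hxy | hxy
    · exact ih v hvd hle
    · obtain ⟨u, hu, hud⟩ := M.exists_vertex_le x
      have huW := ih u hud hu
      have huy := hu.trans_lt hxy
      rcases M.dim_eq_one_or_two_of_lt hxy with h1 | h2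
      · exact hW y hy h1 u v huy (lt_of_le_of_ne hle (by rintro rfl; omega)) huW
      · have hvy : v < y := lt_of_le_of_ne hle (by rintro rfl; omega)
        -- A step up to a face can bring in vertices not on a common edge with `u`; they are reached
        -- by walking around the boundary of the face.
        refine ((M.face_boundary_connected y h2).2 u huy v hvy).induction
          (p := fun c => ∀ v, M.dim v = 0 → v ≤ c → v ∈ W) ?_ ?_ v hvd le_rfl
        · rintro v - hle
          rwa [eq_of_le_of_dim_eq_zero hud hle]
        · intro a ha b hb hab ih v hvd hle
          rcases hab.eq_or_lt with rfl | hab | hab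
          · exact ih v hvd hle
          · have h1 := M.dim_eq_one_of_lt_of_lt hab hb
            have h0 := M.dim_eq_zero_of_lt h1 hab
            exact hW b (hK (le_of_lt hb) hy) h1 a v hab
              (lt_of_le_of_ne hle (by rintro rfl; omega)) (ih a h0 le_rfl)
          · exact ih v hvd (hle.trans hab.le)
    · exact ih v hvd (hle.trans hxy.le)

section Cochains

open Classical

variable [Fintype C] {T : Set C} {o : C}

/-- A tree has no nonempty even set of edges. -/
lemma TreeGrowth.eq_zero (h : M.TreeGrowth {o} T) (ho : M.dim o = 0) {ω : C → ZMod 2}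
    (hω : ∀ v, M.dim v = 0 → M.starSum ω v = 0) (hT : ∀ e, M.dim e = 1 → e ∉ T → ω e = 0) :
    ∀ e, M.dim e = 1 → ω e = 0 := by
  induction h with
  | refl =>
    intro e he
    refine hT e he ?_
    rintro rfl
    omega
  | @step T e u v h he hu hv huT hvT ih =>
    have hlow := h.isLowerSet (isLowerSet_singleton ho)
    have hv0 := M.dim_eq_zero_of_lt he hv
    -- `v` is a leaf: `e` is the only edge at `v` that `ω` could contain, so evenness at `v`
    -- excludes it.
    have hωe : ω e = 0 := by
      have := hω v hv0
      unfold starSum at this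
      rwa [Finset.sum_eq_single_of_mem e (by simp [he, hv])] at this
      intro b hb hne
      simp only [Finset.mem_filter, Finset.mem_univ, true_and] at hb
      refine hT b hb.2 ?_
      rintro (rfl | rfl | hbT)
      · exact hne rfl
      · exact hb.1.false
      · exact hvT (hlow hb.1.le hbT)
    refine ih fun e' he' he'T => ?_
    by_cases hee : e' = e
    · rw [hee, hωe]
    · refine hT e' he' ?_
      rintro (rfl | rfl | hbT)
      · exact hee rfl
      · omega
      · exact he'T hbT

/-- Every vertex of a tree can be joined to the root. -/
lemma TreeGrowth.exists_starSum (h : M.TreeGrowth {o} T) (ho : M.dim o = 0) :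
    ∀ v ∈ T, M.dim v = 0 → ∃ ω : C → ZMod 2, (∀ e, M.dim e = 1 → e ∉ T → ω e = 0) ∧
      ∀ x, M.starSum ω x = (if x = v then 1 else 0) + if x = o then 1 else 0 := by
  induction h with
  | refl =>
    rintro v rfl -
    refine ⟨0, fun _ _ _ => rfl, fun x => ?_⟩
    rw [CharTwo.add_self_eq_zero]
    simp [starSum]
  | @step T e u v h he hu hv huT hvT ih =>
    rintro x (rfl | rfl | hx) hx0
    · omega
    · obtain ⟨ω, h1, h2⟩ := ih u huT (M.dim_eq_zero_of_lt he hu)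
      refine ⟨ω + Pi.single e 1, fun e' he' he'T => ?_, fun y => ?_⟩
      · have h3 : e' ≠ e := fun h => he'T (Or.inl h)
        simp [h1 e' he' fun h => he'T (Or.inr (Or.inr h)), h3]
      · have hux : u ≠ x := by rintro rfl; exact hvT huT
        rw [starSum_add, h2, starSum_single he]
        simp only [lt_iff_of_ends he hu hv hux]
        by_cases h3 : y = u
        · subst h3
          simp only [true_or, if_true, hux, if_false, zero_add]
          rw [add_right_comm, CharTwo.add_self_eq_zero, zero_add]
        · simp [h3, add_comm]
    · obtain ⟨ω, h1, h2⟩ := ih x hx hx0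
      exact ⟨ω, fun e' he' he'T => h1 e' he' fun h => he'T (Or.inr (Or.inr h)), h2⟩

/-- The star of a vertex stays connected if one edge is removed. -/
lemma isConnectedRegion_star_diff {v e : C} (hv : M.dim v = 0) (he : v < e) (hd : M.dim e = 1) :
    IsConnectedRegion (Set.Ioi v \ {e}) := by
  obtain ⟨f₀, _, _, hf⟩ := M.exists_faces hd
  have hef := (hf f₀).2 (Or.inl rfl)
  have hd₀ := M.dim_eq_two_of_lt hd hef
  have hmem : ∀ f, v < f → M.dim f = 2 → f ∈ Set.Ioi v \ {e} := fun f h1 h2 =>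
    ⟨h1, by rintro rfl; omega⟩
  have hf₀ := hmem f₀ (he.trans hef) hd₀
  have face : ∀ f, v < f → M.dim f = 2 → Linked (Set.Ioi v \ {e}) f₀ f := by
    intro f hvf hdf
    -- The indicator of the component of `f₀` does not jump across any edge at `v` other than `e`,
    -- hence is constant.
    have := eq_of_star_of_ne hv he hd
      (g := fun f => if Linked (Set.Ioi v \ {e}) f₀ f then 1 else 0)
      (fun e' he' hd' hne => by
        rw [sideSum_eq_zero_iff hd']
        intro f f' hf hf'
        have h1 := hmem f (he'.trans hf) (M.dim_eq_two_of_lt hd' hf)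
        have h2 := hmem f' (he'.trans hf') (M.dim_eq_two_of_lt hd' hf')
        have h3 : e' ∈ Set.Ioi v \ {e} := ⟨he', hne⟩
        have h4 : Linked (Set.Ioi v \ {e}) f f' :=
          (Linked.single h1 h3 (Or.inr hf.le)).trans (Linked.single h3 h2 (Or.inl hf'.le))
        have h5 : Linked (Set.Ioi v \ {e}) f₀ f ↔ Linked (Set.Ioi v \ {e}) f₀ f' :=
          ⟨fun h => h.trans h4, fun h => h.trans h4.symm⟩
        simp only [h5])
      hf₀.1 hvf hd₀ hdf
    have h1 : Linked (Set.Ioi v \ {e}) f₀ f₀ := Relation.ReflTransGen.refl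
    by_contra h2
    simp [h1, h2] at this
  have all : ∀ c ∈ Set.Ioi v \ {e}, Linked (Set.Ioi v \ {e}) f₀ c := by
    intro c hc
    obtain ⟨f, hcf, hdf⟩ := M.exists_face_ge c
    have hvf : v < f := lt_of_lt_of_le hc.1 hcf
    exact (face f hvf hdf).trans (Linked.single (hmem f hvf hdf) hc (Or.inr hcf))
  exact ⟨⟨f₀, hf₀⟩, fun a ha b hb => (all a ha).symm.trans (all b hb)⟩

variable {G : Type*} [Group G]

/-- If the complement of a tree is simply connected, then so is the complement of a smaller tree. -/
lemma TreeGrowth.hasPotentials_compl {B : Set C} (h : M.TreeGrowth B T) (hB : IsLowerSet B)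
    (hB1 : ∀ c ∈ B, M.dim c ≤ 1) (hT : HasPotentials G Tᶜ) : HasPotentials G Bᶜ := by
  induction h with
  | refl => exact hT
  | @step T e u v h he hu hv huT hvT ih =>
    apply ih
    have hlow := h.isLowerSet hB
    have hdim := h.dim_le_one hB1
    have hv0 := M.dim_eq_zero_of_lt he hv
    have heT : e ∉ T := fun h => hvT (hlow hv.le h)
    have huv : u ≠ v := by rintro rfl; exact hvT huT
    have hlink : {a | a ∈ (insert e (insert v T))ᶜ ∧ (a < v ∨ v < a)} = Set.Ioi v \ {e} := by
      ext a
      constructor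
      · rintro ⟨ha, h1 | h1⟩
        · have := M.dim_strictMono h1
          omega
        · exact ⟨h1, fun h2 => ha (Or.inl h2)⟩
      · rintro ⟨ha, hae⟩
        refine ⟨?_, Or.inr ha⟩
        rintro (h1 | h1 | h1)
        · exact hae h1
        · rw [h1] at ha
          exact lt_irrefl v ha
        · exact hvT (hlow (le_of_lt ha) h1)
    have h1 : HasPotentials G (insert v (insert e (insert v T))ᶜ) := by
      refine hT.insert (fun h => h (Or.inr (Or.inl rfl))) ?_
      rw [hlink]
      exact isConnectedRegion_star_diff hv0 hv he
    -- With `v` restored and `u` still absent, the link of `e` is `v` together with the two faces at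
    -- `e`, a cone with apex `v`.
    have h2 : HasPotentials G (insert e (insert v (insert e (insert v T))ᶜ)) := by
      refine h1.insert ?_ ?_
      · rintro (rfl | h)
        · exact hv.false
        · exact h (Or.inl rfl)
      · refine isConnectedRegion_of_cone (x := v) ⟨Or.inl rfl, Or.inl hv⟩ ?_
        rintro a ⟨ha | ha, hae | hae⟩
        · exact Or.inl ha.ge
        · exact Or.inl ha.ge
        · rcases (lt_iff_of_ends he hu hv huv).1 hae with rfl | rfl
          · exact absurd (Or.inr (Or.inr huT)) ha
          · exact Or.inl le_rfl
        · exact Or.inl (hv.trans hae).le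
    convert h2 using 1
    ext x
    simp only [Set.mem_compl_iff, Set.mem_insert_iff, not_or]
    by_cases hxe : x = e
    · simp [hxe, heT]
    · by_cases hxv : x = v
      · simp [hxv, hvT]
      · simp [hxe, hxv]

/-- The complement of a spanning tree of a simply connected surface is simply connected. -/
lemma TreeGrowth.hasPotentials_compl_of_spanning
    (hM : HasPotentials (Multiplicative (ZMod 2)) (Set.univ : Set C))
    (hc : IsPreconnectedRegion (Set.univ : Set C)) (ho : M.dim o = 0) (h : M.TreeGrowth {o} T)
    (hT : ∀ v, M.dim v = 0 → v ∈ T) : HasPotentials G Tᶜ := by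
  have hT1 : ∀ c ∈ T, M.dim c ≤ 1 := h.dim_le_one (by rintro c rfl; omega)
  have hface : ∀ f, M.dim f = 2 → f ∈ Tᶜ := fun f hf hfT => by
    have := hT1 f hfT
    omega
  have hpos : ∀ c ∈ Tᶜ, 0 < M.dim c := fun c hc => Nat.pos_of_ne_zero fun h => hc (hT c h)
  obtain ⟨f₀, -, hf₀⟩ := M.exists_face_ge o
  obtain ⟨D, hD₀, hD⟩ := Finite.exists_le_maximal (a := ({f₀} : Set C))
    (p := fun D => D ⊆ Tᶜ ∧ IsUpperSet D ∧ IsPreconnectedRegion D ∧ HasPotentials G D) <| by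
      refine ⟨Set.singleton_subset_iff.2 (hface f₀ hf₀), ?_, ?_, ?_⟩
      · rintro x y hxy rfl
        rcases hxy.eq_or_lt with h | h
        · exact h.symm
        · have := M.dim_strictMono h
          have := M.dim_le_two y
          omega
      · exact (isConnectedRegion_of_cone (Set.mem_singleton f₀) (by rintro _ rfl; exact Or.inl le_rfl)).2
      · refine fun w _ => ⟨1, ?_⟩
        rintro _ rfl _ rfl hlt
        exact absurd hlt (lt_irrefl _)
  obtain ⟨hDT, hDu, hDc, hDG⟩ := hD.prop
  -- Otherwise `e` and then `f'` could be added to `D`: the link of `e` is just `f`, as its ends lie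
  -- in the tree, and the link of `f'` is then just `e`.
  have hmax : ∀ e, M.dim e = 1 → e ∉ T → ∀ f f', e < f → e < f' → f ∈ D → f' ∈ D := by
    intro e he heT f f' hf hf' hfD
    by_contra hf'D
    have hne : f ≠ f' := by rintro rfl; exact hf'D hfD
    have heD : e ∉ D := fun h => hf'D (hDu hf'.le h)
    have hfd := M.dim_eq_two_of_lt he hf
    have hfd' := M.dim_eq_two_of_lt he hf'
    have hsides : ∀ x, e < x → x = f ∨ x = f' := by
      obtain ⟨a, b, hab, h⟩ := M.exists_faces he
      intro x hx
      rcases (h f).1 hf with rfl | rfl <;> rcases (h f').1 hf' with rfl | rfl <;>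
        rcases (h x).1 hx with rfl | rfl <;> simp_all
    have h1 : HasPotentials G (insert e D) := by
      refine hDG.insert heD (isConnectedRegion_of_cone (x := f) ⟨hfD, Or.inr hf⟩ ?_)
      rintro a ⟨ha, hae | hae⟩
      · have := M.dim_strictMono hae
        have := hpos a (hDT ha)
        omega
      · rcases hsides a hae with rfl | rfl
        · exact Or.inl le_rfl
        · exact absurd ha hf'D
    have h2 : HasPotentials G (insert f' (insert e D)) := by
      refine h1.insert ?_ (isConnectedRegion_of_cone (x := e) ⟨Or.inl rfl, Or.inl hf'⟩ ?_)
      · rintro (rfl | h)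
        · omega
        · exact hf'D h
      · rintro a ⟨rfl | ha, hae | hae⟩
        · exact Or.inl le_rfl
        · exact Or.inl le_rfl
        · exact absurd (hDu hae.le ha) hf'D
        · have := M.dim_strictMono hae
          have := M.dim_le_two a
          omega
    have h3 : insert f' (insert e D) ⊆ D := by
      refine hD.le_of_ge ⟨?_, ?_, ?_, h2⟩ fun x hx => Or.inr (Or.inr hx)
      · rintro x (rfl | rfl | hx)
        · exact hface x hfd'
        · exact heT
        · exact hDT hx
      · rintro x y hxy (rfl | rfl | hx)
        · rcases hxy.eq_or_lt with rfl | hlt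
          · exact Or.inl rfl
          · have := M.dim_strictMono hlt
            have := M.dim_le_two y
            omega
        · rcases hxy.eq_or_lt with rfl | hlt
          · exact Or.inr (Or.inl rfl)
          · rcases hsides y hlt with rfl | rfl
            · exact Or.inr (Or.inr hfD)
            · exact Or.inl rfl
        · exact Or.inr (Or.inr (hDu hxy hx))
      · exact (hDc.insert_of_incident hfD (Or.inr hf.le)).insert_of_incident (Or.inl rfl)
          (Or.inl hf'.le)
    exact hf'D (h3 (Or.inl rfl))
  have hDface : ∀ f, M.dim f = 2 → f ∈ D := by
    intro f hf
    -- The mod 2 boundary of the faces of `D` is an even edge set inside the tree, so it is empty.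
    have h0 : ∀ e, M.dim e = 1 → sideSum (fun f => if f ∈ D then 1 else 0) e = 0 := by
      refine h.eq_zero ho (fun v hv => starSum_sideSum hv _) fun e he heT => ?_
      rw [sideSum_eq_zero_iff he]
      intro f f' hf hf'
      have : f ∈ D ↔ f' ∈ D := ⟨hmax e he heT f f' hf hf', hmax e he heT f' f hf' hf⟩
      simp only [this]
    have h1 := eq_of_isPreconnectedRegion (M := M) isUpperSet_univ hc (fun e _ he => h0 e he)
      (Set.mem_univ f₀) (Set.mem_univ f) hf₀ hf
    have h2 : f₀ ∈ D := hD₀ rfl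
    by_contra h3
    simp [h2, h3] at h1
  have hDedge : ∀ e, M.dim e = 1 → e ∉ T → e ∈ D := by
    intro e he heT
    by_contra heD
    obtain ⟨u, v, huv, hends⟩ := M.exists_ends he
    have hu := M.dim_eq_zero_of_lt he ((hends u).2 (Or.inl rfl))
    have hv := M.dim_eq_zero_of_lt he ((hends v).2 (Or.inr rfl))
    obtain ⟨ω₁, h1, h1'⟩ := h.exists_starSum ho u (hT u hu) hu
    obtain ⟨ω₂, h2, h2'⟩ := h.exists_starSum ho v (hT v hv) hv
    -- The cycle closed by `e`: tree paths from the root to both ends of `e`, plus `e` itself. It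
    -- bounds `g`, but `D` connects the two sides of `e` without crossing the cycle, so `g` cannot
    -- jump at `e`.
    obtain ⟨g, hg⟩ := exists_sideSum_eq (M := M) hM (ω := ω₁ + ω₂ + Pi.single e 1) <| by
      intro x hx
      rw [starSum_add, starSum_add, h1', h2', starSum_single he]
      simp only [hends]
      have h3 : (if x = u ∨ x = v then (1 : ZMod 2) else 0) =
          (if x = u then 1 else 0) + (if x = v then 1 else 0) := by
        by_cases hxu : x = u
        · subst hxu
          simp [huv]
        · simp [hxu]
      rw [h3]
      generalize (if x = u then (1 : ZMod 2) else 0) = a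
      generalize (if x = v then (1 : ZMod 2) else 0) = b
      generalize (if x = o then (1 : ZMod 2) else 0) = c
      revert a b c
      decide
    have hzero : sideSum g e = 0 := by
      rw [sideSum_eq_zero_iff he]
      intro f f' hf hf'
      have hd := M.dim_eq_two_of_lt he hf
      have hd' := M.dim_eq_two_of_lt he hf'
      refine eq_of_isPreconnectedRegion hDu hDc (fun e' he'D hd' => ?_) (hDface f' hd')
        (hDface f hd) hd' hd
      have hne : e' ≠ e := by rintro rfl; exact heD he'D
      rw [hg e' hd']
      simp [h1 e' hd' (hDT he'D), h2 e' hd' (hDT he'D), hne]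
    rw [hg e he] at hzero
    simp [h1 e he heT, h2 e he heT] at hzero
  have : D = Tᶜ := by
    refine subset_antisymm hDT fun c hcT => ?_
    have h1 := hpos c hcT
    have h2 := M.dim_le_two c
    interval_cases h3 : M.dim c
    · exact hDedge c h3 hcT
    · exact hDface c h3
  exact this ▸ hDG

end Cochains

end Trees

end ClosedSurface

end DiscreteSurface

namespace DiscreteSurface

/-! ### Patches and closed patches -/

namespace Partition

variable {C : Type*} [PartialOrder C] {M : ClosedSurface C} {P : Partition M} {U : Set C}

lemma IsPatch.subset (hU : P.IsPatch U) : U ⊆ P.networkᶜ := by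
  obtain ⟨x, hx, rfl⟩ := hU
  exact fun y hy => Linked.mem hy hx

lemma IsPatch.mem_of_incident (hU : P.IsPatch U) {a b : C} (ha : a ∈ U) (hb : b ∈ P.networkᶜ)
    (hab : Incident a b) : b ∈ U := by
  have ha' := hU.subset ha
  obtain ⟨x, hx, rfl⟩ := hU
  exact Relation.ReflTransGen.trans ha (Linked.single ha' hb hab)

lemma IsPatch.isUpperSet (hU : P.IsPatch U) : IsUpperSet U := fun _ _ hab ha =>
  hU.mem_of_incident ha (fun hb => hU.subset ha (P.isLowerSet hab hb)) (Or.inl hab)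

lemma IsPatch.isConnectedRegion (hU : P.IsPatch U) : IsConnectedRegion U := by
  have hU' := hU
  obtain ⟨x, hx, hUx⟩ := hU'
  have hxU : x ∈ U := by
    rw [hUx]
    exact Relation.ReflTransGen.refl
  have key : ∀ y ∈ U, Linked U x y := by
    intro y hy
    have h : Linked P.networkᶜ x y := by rwa [hUx] at hy
    refine (h.induction (p := fun z => z ∈ U ∧ Linked U x z)
      ⟨hxU, Relation.ReflTransGen.refl⟩ ?_).2
    rintro a _ b hb hab ⟨haU, hxa⟩
    have hbU := hU.mem_of_incident haU hb hab
    exact ⟨hbU, hxa.trans (Linked.single haU hbU hab)⟩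
  exact ⟨⟨x, hxU⟩, fun a ha b hb => (key a ha).symm.trans (key b hb)⟩

/-- A maximal tree `T` in the connected network contains all its vertices, so `Tᶜ` exceeds the
complement of the network only by edges. No chain of three cells in `Tᶜ` contains such an edge, so a
cocycle off the network is already one on `Tᶜ`, whatever its values at those edges. -/
lemma hasPotentials_compl_network [Finite C] (hM : IsSimplyConnected (Set.univ : Set C))
    (hP : IsPreconnectedRegion P.network) (G : Type*) [Group G] :
    HasPotentials G P.networkᶜ := by
  have := Fintype.ofFinite C
  rcases P.network.eq_empty_or_nonempty with h0 | ⟨c, hc⟩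
  · rw [h0, Set.compl_empty]
    exact hM.hasPotentials
  obtain ⟨o, hoc, ho⟩ := M.exists_vertex_le c
  have hoP : o ∈ P.network := P.isLowerSet hoc hc
  obtain ⟨T, hT, hTP, hTmax⟩ := ClosedSurface.exists_maximal_treeGrowth (M := M)
    (Set.singleton_subset_iff.2 hoP) P.isLowerSet
  obtain ⟨T', hT', -, hTmax'⟩ := ClosedSurface.exists_maximal_treeGrowth (M := M)
    (Set.subset_univ T) isLowerSet_univ
  have hoT : o ∈ T := hT.subset rfl
  have hTlow := hT.isLowerSet (ClosedSurface.isLowerSet_singleton ho)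
  have hTG : HasPotentials G Tᶜ := hT'.hasPotentials_compl hTlow
    (fun c hc => P.dim_le_one c (hTP hc)) <|
      (hT.trans hT').hasPotentials_compl_of_spanning hM.hasPotentials hM.1.2 ho fun v hv =>
        ClosedSurface.mem_of_isPreconnectedRegion isLowerSet_univ hM.1.2 hTmax' (Set.mem_univ o) ho
          (hT'.subset hoT) (Set.mem_univ v) hv
  have hvert : ∀ v ∈ P.network, M.dim v = 0 → v ∈ T := fun v hv hv0 =>
    ClosedSurface.mem_of_isPreconnectedRegion P.isLowerSet hP hTmax hoP ho hoT hv hv0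
  have hlink : ∀ a ∈ Tᶜ, ∀ b, a < b → b ∈ P.network → False := by
    intro a ha b hab hb
    have h1 := M.dim_strictMono hab
    have h2 := P.dim_le_one b hb
    exact ha (hvert a (P.isLowerSet hab.le hb) (by omega))
  intro w hw
  obtain ⟨g, hg⟩ := hTG w <| by
    intro a ha b hb c hc hab hbc
    have hbP : b ∉ P.network := hlink a ha b hab
    have hcP : c ∉ P.network := hlink b hb c hbc
    by_cases haP : a ∈ P.network
    · have h1 := M.dim_strictMono hab
      have h2 := M.dim_strictMono hbc
      have h3 := M.dim_le_two c
      exact absurd (hvert a haP (by omega)) ha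
    · exact hw a haP b hbP c hcP hab hbc
  exact ⟨g, fun a ha b hb => hg a (fun h => ha (hTP h)) b fun h => hb (hTP h)⟩

/-- A patch is a component of the complement, so a cocycle on it extends by `1` to the other
components. -/
lemma IsPatch.hasPotentials (hU : P.IsPatch U) {G : Type*} [Group G]
    (h : HasPotentials G P.networkᶜ) : HasPotentials G U := by
  classical
  intro w hw
  obtain ⟨g, hg⟩ := h (fun a b => if a ∈ U then w a b else 1) <| by
    intro a ha b hb c hc hab hbc
    have h1 : a ∈ U → b ∈ U := fun h => hU.mem_of_incident h hb (Or.inl hab.le)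
    have h2 : b ∈ U → a ∈ U := fun h => hU.mem_of_incident h ha (Or.inr hab.le)
    have h3 : b ∈ U → c ∈ U := fun h => hU.mem_of_incident h hc (Or.inl hbc.le)
    by_cases haU : a ∈ U
    · simp only [haU, h1 haU, if_true]
      exact hw a haU b (h1 haU) c (h3 (h1 haU)) hab hbc
    · simp [haU, mt h2 haU]
  refine ⟨g, fun a ha b hb hab => ?_⟩
  rw [← hg a (hU.subset ha) b (hU.subset hb) hab, if_pos ha]

lemma subset_closedPatch : U ⊆ P.closedPatch U := fun c hc => ⟨c, hc, le_rfl⟩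

lemma IsPatch.closedPatch_eq (hU : P.IsPatch U) :
    P.closedPatch U = U ∪ {e ∈ P.patchBoundary U | M.dim e = 1} ∪
      {v ∈ P.patchBoundary U | M.dim v = 0} := by
  ext c
  constructor
  · intro hc
    by_cases hcP : c ∈ P.network
    · have := P.dim_le_one c hcP
      interval_cases h : M.dim c
      · exact Or.inr ⟨⟨hc, hcP⟩, h⟩
      · exact Or.inl (Or.inr ⟨⟨hc, hcP⟩, h⟩)
    · obtain ⟨d, hd, hcd⟩ := hc
      exact Or.inl (Or.inl (hU.mem_of_incident hd hcP (Or.inr hcd)))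
  · rintro ((h | h) | h)
    · exact subset_closedPatch h
    · exact h.1.1
    · exact h.1.1

lemma IsPatch.isConnectedRegion_closedPatch (hU : P.IsPatch U) :
    IsConnectedRegion (P.closedPatch U) := by
  obtain ⟨⟨x, hx⟩, hc⟩ := hU.isConnectedRegion
  have key : ∀ a ∈ P.closedPatch U, Linked (P.closedPatch U) x a := by
    rintro a ⟨d, hd, had⟩
    exact ((hc x hx d hd).mono subset_closedPatch).trans
      (Linked.single (subset_closedPatch hd) ⟨d, hd, had⟩ (Or.inr had))
  exact ⟨⟨x, subset_closedPatch hx⟩, fun a ha b hb => (key a ha).symm.trans (key b hb)⟩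

lemma IsPatch.exists_face_of_mem_patchBoundary (hU : P.IsPatch U) {c : C}
    (hc : c ∈ P.patchBoundary U) : ∃ f ∈ U, c < f ∧ M.dim f = 2 := by
  obtain ⟨⟨d, hd, hcd⟩, hcP⟩ := hc
  obtain ⟨f, hdf, hf⟩ := M.exists_face_ge d
  refine ⟨f, hU.isUpperSet hdf hd, lt_of_le_of_ne (hcd.trans hdf) ?_, hf⟩
  rintro rfl
  have := P.dim_le_one c hcP
  omega

/-- A simple boundary separates the surface: no boundary edge has the patch on both sides. -/
lemma HasSimpleBoundary.eq_of_lt (hB : P.HasSimpleBoundary U) [Finite C]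
    (hM : IsSimplyConnected (Set.univ : Set C)) (hU : P.IsPatch U) {e f f' : C}
    (he : e ∈ P.patchBoundary U) (hd : M.dim e = 1) (hf : e < f) (hf' : e < f') (hfU : f ∈ U)
    (hfU' : f' ∈ U) : f = f' := by
  classical
  have := Fintype.ofFinite C
  by_contra hne
  -- Two boundary edges, or none, end at each vertex, so the boundary is even and bounds `g`. Being
  -- constant on the patch, `g` cannot jump at an edge with the patch on both sides.
  obtain ⟨g, hg⟩ := ClosedSurface.exists_sideSum_eq (M := M) hM.hasPotentials
    (ω := fun e => if e ∈ P.patchBoundary U then 1 else 0) <| by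
      intro v hv
      unfold ClosedSurface.starSum
      rw [← Finset.sum_filter, Finset.sum_const, nsmul_one, Finset.filter_filter]
      by_cases hvB : v ∈ P.patchBoundary U
      · have h := hB v hvB hv
        rw [Set.ncard_eq_toFinset_card'] at h
        have h2 : (Finset.univ.filter fun a => (v < a ∧ M.dim a = 1) ∧ a ∈ P.patchBoundary U) =
            {e | e ∈ P.patchBoundary U ∧ v < e}.toFinset := by
          ext a
          simp only [Finset.mem_filter, Finset.mem_univ, true_and, Set.mem_toFinset,
            Set.mem_ofPred_eq]
          refine ⟨fun h => ⟨h.2, h.1.1⟩, fun h => ⟨⟨h.2, ?_⟩, h.1⟩⟩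
          have h1 := M.dim_strictMono h.2
          have h2 := P.dim_le_one a h.1.2
          omega
        rw [h2, h]
        rfl
      · have h2 : (Finset.univ.filter fun a =>
            (v < a ∧ M.dim a = 1) ∧ a ∈ P.patchBoundary U) = ∅ := by
          refine Finset.filter_eq_empty_iff.2 ?_
          rintro a - ⟨⟨hva, -⟩, ⟨d, hd, had⟩, haP⟩
          exact hvB ⟨⟨d, hd, hva.le.trans had⟩, P.isLowerSet hva.le haP⟩
        rw [h2]
        rfl
  have h1 : g f' = g f := ClosedSurface.eq_of_isPreconnectedRegion hU.isUpperSet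
    hU.isConnectedRegion.2 (fun e' he' hd' => by
      rw [hg e' hd', if_neg fun h => hU.subset he' h.2]) hfU hfU'
      (M.dim_eq_two_of_lt hd hf) (M.dim_eq_two_of_lt hd hf')
  have h2 := hg e hd
  rw [ClosedSurface.sideSum_eq_add hd hf hf' hne, h1, CharTwo.add_self_eq_zero, if_pos he] at h2
  exact zero_ne_one h2

/-- Around `v` the patch forms a single sector between the boundary edges `e₁` and `e₂`: a component
of the link missing the patch face `f₀` at `e₁` could end only at `e₂`, and one edge alone does not
separate the star. -/
lemma HasSimpleBoundary.isConnectedRegion_link (hB : P.HasSimpleBoundary U) [Finite C]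
    (hM : IsSimplyConnected (Set.univ : Set C)) (hU : P.IsPatch U) {v : C}
    (hv : v ∈ P.patchBoundary U) (hd : M.dim v = 0) :
    IsConnectedRegion {a | a ∈ U ∪ {e ∈ P.patchBoundary U | M.dim e = 1} ∧ (a < v ∨ v < a)} := by
  classical
  have := Fintype.ofFinite C
  set L := {a | a ∈ U ∪ {e ∈ P.patchBoundary U | M.dim e = 1} ∧ (a < v ∨ v < a)} with hL
  obtain ⟨e₁, e₂, hne, he⟩ := Set.ncard_eq_two.1 (hB v hv hd)
  have he' : ∀ e, e ∈ P.patchBoundary U ∧ v < e ↔ e = e₁ ∨ e = e₂ := fun e => by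
    simpa using Set.ext_iff.1 he e
  have hdim : ∀ e, e ∈ P.patchBoundary U → v < e → M.dim e = 1 := fun e h1 h2 => by
    have h3 := M.dim_strictMono h2
    have h4 := P.dim_le_one e h1.2
    omega
  obtain ⟨hB₁, hv₁⟩ := (he' e₁).2 (Or.inl rfl)
  obtain ⟨-, hv₂⟩ := (he' e₂).2 (Or.inr rfl)
  have hB₂ := ((he' e₂).2 (Or.inr rfl)).1
  have hd₁ := hdim e₁ hB₁ hv₁
  have hd₂ := hdim e₂ hB₂ hv₂
  obtain ⟨f₀, hf₀U, hef₀, hdf₀⟩ := hU.exists_face_of_mem_patchBoundary hB₁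
  obtain ⟨f₁, hf₁, hf₁U⟩ : ∃ f, e₁ < f ∧ f ∉ U := by
    obtain ⟨a, b, hab, h⟩ := M.exists_faces hd₁
    by_contra! hall
    have ha := (h a).2 (Or.inl rfl)
    have hb := (h b).2 (Or.inr rfl)
    exact hab (hB.eq_of_lt hM hU hB₁ hd₁ ha hb (hall a ha) (hall b hb))
  have hmem : ∀ c ∈ U, v < c → c ∈ L := fun c hc hvc => ⟨Or.inl hc, Or.inr hvc⟩
  have face : ∀ f ∈ U, v < f → M.dim f = 2 → Linked L f f₀ := by
    intro f hfU hvf hdf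
    by_contra hnot
    have hKU : ∀ x, Linked L f x → M.dim x = 2 → x ∈ U := fun x hx hx2 => by
      rcases (hx.mem (hmem f hfU hvf)).1 with h | h
      · exact h
      · have := h.2
        omega
    have := ClosedSurface.eq_of_star_of_ne hd hv₂ hd₂
      (g := fun x => if Linked L f x then 1 else 0) (fun e hve hde hne₂ => by
        rw [ClosedSurface.sideSum_eq_zero_iff hde]
        intro x x' hx hx'
        by_cases heB : e ∈ P.network
        · have hnone : ∀ y, e < y → ¬ Linked L f y := by
            intro y hy hlink
            have hyU := hKU y hlink (M.dim_eq_two_of_lt hde hy)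
            rcases (he' e).1 ⟨⟨⟨y, hyU, hy.le⟩, heB⟩, hve⟩ with rfl | rfl
            · rw [hB.eq_of_lt hM hU hB₁ hd₁ hy hef₀ hyU hf₀U] at hlink
              exact hnot hlink
            · exact hne₂ rfl
          simp only [hnone x hx, hnone x' hx']
        · have hside : ∀ y y', e < y → e < y' → Linked L f y → Linked L f y' := by
            intro y y' hy hy' hlink
            have hyU := hKU y hlink (M.dim_eq_two_of_lt hde hy)
            have heU : e ∈ U := hU.mem_of_incident hyU heB (Or.inr hy.le)
            have hyU' : y' ∈ U := hU.isUpperSet hy'.le heU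
            exact (hlink.trans (Linked.single (hmem y hyU (hve.trans hy)) (hmem e heU hve)
              (Or.inr hy.le))).trans (Linked.single (hmem e heU hve)
                (hmem y' hyU' (hve.trans hy')) (Or.inl hy'.le))
          have : Linked L f x ↔ Linked L f x' := ⟨hside x x' hx hx', hside x' x hx' hx⟩
          simp only [this])
      hvf (hv₁.trans hef₀) hdf hdf₀
    have h1 : Linked L f f := Relation.ReflTransGen.refl
    simp [hnot, h1] at this
  have all : ∀ c ∈ L, Linked L c f₀ := by
    rintro c ⟨hc, hcv | hvc⟩
    · have := M.dim_strictMono hcv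
      omega
    · rcases hc with hcU | hcB
      · obtain ⟨f, hcf, hdf⟩ := M.exists_face_ge c
        have hfU := hU.isUpperSet hcf hcU
        have hvf := hvc.trans_le hcf
        exact (Linked.single (hmem c hcU hvc) (hmem f hfU hvf) (Or.inl hcf)).trans
          (face f hfU hvf hdf)
      · obtain ⟨f, hfU, hcf, hdf⟩ := hU.exists_face_of_mem_patchBoundary hcB.1
        have hvf := hvc.trans hcf
        have hcL : c ∈ L := ⟨Or.inr hcB, Or.inr hvc⟩
        exact (Linked.single hcL (hmem f hfU hvf) (Or.inl hcf.le)).trans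
          (face f hfU hvf hdf)
  exact ⟨⟨f₀, hmem f₀ hf₀U (hv₁.trans hef₀)⟩, fun a ha b hb => (all a ha).trans (all b hb).symm⟩

/-- Edges must precede vertices: the link of a boundary edge in `U` is a single face, while the link
of a boundary vertex is taken with the boundary edges already present. -/
lemma HasSimpleBoundary.hasPotentials_closedPatch (hB : P.HasSimpleBoundary U) [Finite C]
    (hM : IsSimplyConnected (Set.univ : Set C)) (hU : P.IsPatch U) {G : Type*} [Group G]
    (h : HasPotentials G U) : HasPotentials G (P.closedPatch U) := by
  rw [hU.closedPatch_eq]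
  refine (h.union ?_ (fun x hx hxU => hU.subset hxU hx.1.2) ?_).union ?_ ?_ ?_
  · rintro x hx y hy hxy
    have := M.dim_strictMono hxy
    have := hx.2
    have := hy.2
    omega
  · rintro e ⟨he, hd⟩
    obtain ⟨f, hfU, hef, -⟩ := hU.exists_face_of_mem_patchBoundary he
    refine isConnectedRegion_of_cone (x := f) ⟨hfU, Or.inr hef⟩ ?_
    rintro a ⟨haU, hae | hae⟩
    · exact absurd (P.isLowerSet hae.le he.2) (hU.subset haU)
    · exact Or.inl (hB.eq_of_lt hM hU he hd hef hae hfU haU).le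
  · rintro x hx y hy hxy
    have := M.dim_strictMono hxy
    have := hx.2
    have := hy.2
    omega
  · rintro x hx (hxU | hxB)
    · exact hU.subset hxU hx.1.2
    · have := hx.2
      have := hxB.2
      omega
  · exact fun v hv => hB.isConnectedRegion_link hM hU hv.1 hv.2

end Partition

end DiscreteSurface

theorem lemma3p1 {C : Type*} [PartialOrder C] (M : DiscreteSurface.ClosedSurface C)
    (hM : DiscreteSurface.IsSimplyConnected (Set.univ : Set C))
    (P : DiscreteSurface.Partition M)
    (hP : DiscreteSurface.IsPreconnectedRegion P.network)
    (U : Set C) (hU : P.IsPatch U) :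
    DiscreteSurface.IsSimplyConnected U ∧
      (P.HasSimpleBoundary U → DiscreteSurface.IsSimplyConnected (P.closedPatch U)) := by
  have := M.finite
  have hG := fun (G : Type _) [Group G] =>
    hU.hasPotentials (DiscreteSurface.Partition.hasPotentials_compl_network hM hP G)
  exact ⟨DiscreteSurface.isSimplyConnected_of_hasPotentials hU.isConnectedRegion fun G _ => hG G,
    fun hB => DiscreteSurface.isSimplyConnected_of_hasPotentials hU.isConnectedRegion_closedPatch
      fun G _ => hB.hasPotentials_closedPatch hM hU (hG G)⟩
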